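/- Let $n\ge 1$. The cake is the interval $[0,1]$; a piece is a Borel subset of $[0,1]$; an allocation is an ordered partition $X=(X_1,\dots,X_n)$ of $[0,1]$ into $n$ disjoint (possibly empty) pieces. The type of an agent is a utility function, i.e. a non-atomic Borel measure $u$ on $[0,1]$ with $u([0,1])=1$. For a profile $u=(u_1,\dots,u_n)$, an allocation $X$ is envy-free if $u_i(X_i)\ge u_i(X_j)$ for all $i,j$; it is Pareto-optimal if there is no allocation $Y$ with $u_i(Y_i)\ge u_i(X_i)$ for all $i$ and $u_i(Y_i)>u_i(X_i)$ for some $i$; it is Nash-optimal if it maximizes $\prod_{i} u_i(X_i)$ among all allocations. A direct-revelation mechanism is a function $M$ that maps every profile $u$ of reported utility functions to an allocation $M(u)=(M_1(u),\dots,M_n(u))$. A utility function $u_i'\ne u_i$ is a profitable manipulation for agent $i$ with true utility function $u_i$ if $u_i(M_i(u_i',u_{-i}))>u_i(M_i(u_i,u_{-i}))$ for some profile $u_{-i}$ of reports of the other agents. The mechanism is not-obviously manipulable (NOM) if, for every agent $i$, every $u_i$ and every profitable manipulation $u_i'$, $$\inf_{u_{-i}} u_i(M_i(u_i',u_{-i}))\le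 \inf_{u_{-i}} u_i(M_i(u_i,u_{-i}))\quad\text{and}\quad \sup_{u_{-i}} u_i(M_i(u_i',u_{-i}))\le \sup_{u_{-i}} u_i(M_i(u_i,u_{-i})).$$ Theorem. There exists a NOM direct-revelation mechanism that returns, for every profile of reported utility functions, an allocation that is envy-free and Pareto-optimal with respect to that profile. More precisely, there exists a direct-revelation mechanism that always returns a Nash-optimal allocation, and every such mechanism is NOM and always returns envy-free and Pareto-optimal allocations. -/

import Mathlib

open MeasureTheory

namespace CakeCutting

/-- A utility function on the cake `[0,1]`: a non-atomic (countably additive) measure on the Borel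
sets of the cake, normalized so that the entire cake has value `1`.  The type of an agent is his
utility function. -/
structure Utility where
  /-- the underlying measure -/
  toMeasure : Measure unitInterval
  isProbabilityMeasure : IsProbabilityMeasure toMeasure
  nonatomic : ∀ s, MeasurableSet s → 0 < toMeasure s →
    ∃ t ⊆ s, MeasurableSet t ∧ 0 < toMeasure t ∧ toMeasure t < toMeasure s

/-- The (real) value that the utility function `u` assigns to the piece `S`. -/
noncomputable def Utility.val (u : Utility) (S : Set unitInterval) : ℝ := u.toMeasure.real S

/-- An allocation: an ordered partition of the whole cake into `n` pairwise disjoint pieces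
(Borel sets), where `piece i` is given to agent `i`.  Pieces may be empty. -/
structure Allocation (n : ℕ) where
  /-- the piece of each agent -/
  piece : Fin n → Set unitInterval
  measurableSet_piece : ∀ i, MeasurableSet (piece i)
  disjoint_piece : Pairwise fun i j => Disjoint (piece i) (piece j)
  iUnion_piece : ⋃ i, piece i = Set.univ

/-- No agent prefers the piece received by someone else over his own piece. -/
def Allocation.IsEnvyFree {n : ℕ} (X : Allocation n) (θ : Fin n → Utility) : Prop :=
  ∀ i j, (θ i).val (X.piece j) ≤ (θ i).val (X.piece i)

/-- No other allocation is better for one agent and not worse for the others. -/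
def Allocation.IsParetoOptimal {n : ℕ} (X : Allocation n) (θ : Fin n → Utility) : Prop :=
  ¬ ∃ Y : Allocation n,
    (∀ i, (θ i).val (X.piece i) ≤ (θ i).val (Y.piece i)) ∧
    ∃ i, (θ i).val (X.piece i) < (θ i).val (Y.piece i)

/-- The allocation maximizes the product of the utilities among all allocations. -/
def Allocation.IsNashOptimal {n : ℕ} (X : Allocation n) (θ : Fin n → Utility) : Prop :=
  ∀ Y : Allocation n, ∏ i, (θ i).val (Y.piece i) ≤ ∏ i, (θ i).val (X.piece i)

/-- A (deterministic) direct-revelation mechanism for `n` agents: every agent reports his type, and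
the mechanism returns an allocation. -/
abbrev DirectMechanism (n : ℕ) : Type := (Fin n → Utility) → Allocation n

namespace DirectMechanism

variable {n : ℕ}

/-- The utility of agent `i` of true type `t` when he reports `r` and the others report
`(θ j)` for `j ≠ i`.  The entry `θ i` is overwritten and plays no role. -/
noncomputable def payoff (M : DirectMechanism n) (i : Fin n) (t r : Utility)
    (θ : Fin n → Utility) : ℝ :=
  t.val ((M (Function.update θ i r)).piece i)

/-- Reporting `r ≠ t` is a profitable manipulation for agent `i` of type `t`: for some reports of
the others it is strictly better than reporting `t`. -/
def IsProfitableManipulation (M : DirectMechanism n) (i : Fin n) (t r : Utility) : Prop :=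
  r ≠ t ∧ ∃ θ : Fin n → Utility, M.payoff i t t θ < M.payoff i t r θ

/-- Not-obvious manipulability: no profitable manipulation is better than truth-telling in the worst
case or in the best case over the reports of the other agents. -/
def IsNotObviouslyManipulable (M : DirectMechanism n) : Prop :=
  ∀ (i : Fin n) (t r : Utility), M.IsProfitableManipulation i t r →
    (⨅ θ : Fin n → Utility, M.payoff i t r θ) ≤ (⨅ θ : Fin n → Utility, M.payoff i t t θ) ∧
    (⨆ θ : Fin n → Utility, M.payoff i t r θ) ≤ (⨆ θ : Fin n → Utility, M.payoff i t t θ)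

/-- The mechanism always returns envy-free allocations. -/
def IsEnvyFree (M : DirectMechanism n) : Prop := ∀ θ, (M θ).IsEnvyFree θ

/-- The mechanism always returns Pareto-optimal allocations. -/
def IsParetoOptimal (M : DirectMechanism n) : Prop := ∀ θ, (M θ).IsParetoOptimal θ

/-- The mechanism always returns an allocation that maximizes the product of utilities. -/
def IsNashOptimal (M : DirectMechanism n) : Prop := ∀ θ, (M θ).IsNashOptimal θ

end DirectMechanism

end CakeCutting

namespace CakeCutting

open Set Filter Topology

/-! ### Splitting atomless measures on the unit interval -/

/-! Every envy-free and Pareto-optimal mechanism is NOM, because the values `1/n` and `1` separate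
truth from lies. A truthful agent never envies, so he always gets at least `1/n`; if he lies while
all others report his true type, their lack of envy leaves him at most `1/n`. In the best case, the
others care only about a tiny set, and Pareto-optimality forces a truthful agent's value up to `1`
in the limit (`one_le_iSup_payoff`).

A Nash-optimal allocation with positive product is Pareto-optimal, since an improvement raises the
product, and envy-free, since handing a small part of an envied piece to the envier would raise it
(`IsNashOptimal.isEnvyFree`).

Existence of a Nash optimum goes through fractional allocations. Their utility vectors form a
bounded convex set; at a maximizer `a` of the product over its closure, the first-order condition is
`∑ v i / a i ≤ n`. With densities `g i` for a common measure and `m = max (g i / a i)`, this forces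
fractional allocations approaching `a` to give almost everything to agents attaining the maximum.
Where the set of such agents is constant, their measures are proportional, so splitting one atomless
measure realizes the limit shares by actual pieces (`exists_allocation_ge`). -/

theorem continuous_measureReal_inter_Iic (ν : Measure unitInterval) [IsFiniteMeasure ν]
    [NullSingletonClass ν] (T : Set unitInterval) :
    Continuous fun x => ν.real (T ∩ Iic x) := by
  have key : ∀ x, ν.real (T ∩ Iic x) = ∫ y, (Iic x).indicator (fun _ => (1 : ℝ)) y
      ∂(ν.restrict T) := by
    intro x
    rw [integral_indicator measurableSet_Iic, setIntegral_const, measureReal_restrict_apply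
      measurableSet_Iic, inter_comm]
    simp
  simp_rw [key]
  rw [continuous_iff_continuousAt]
  intro x₀
  refine continuousAt_of_dominated (bound := fun _ => 1) ?_ ?_ ?_ ?_
  · exact Eventually.of_forall fun x =>
      (measurable_const.indicator measurableSet_Iic).aestronglyMeasurable
  · refine Eventually.of_forall fun x => Eventually.of_forall fun y => ?_
    by_cases h : y ∈ Iic x <;> simp [h]
  · exact integrable_const _
  -- For `y ≠ x₀` the indicator is constant in `x` near `x₀`; the exceptional point is null because
  -- `ν` has no atoms.
  · filter_upwards [Measure.ae_ne (ν.restrict T) x₀] with y hy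
    rcases lt_or_gt_of_ne hy with h | h
    · refine (continuousAt_const (y := (1 : ℝ))).congr ?_
      filter_upwards [lt_mem_nhds h] with x hx
      rw [indicator_of_mem]
      exact hx.le
    · refine (continuousAt_const (y := (0 : ℝ))).congr ?_
      filter_upwards [gt_mem_nhds h] with x hx
      rw [indicator_of_notMem]
      simpa using hx

/-- Intermediate value theorem for a knife sweeping over `T` from left to right. -/
theorem exists_measurable_subset_measureReal_eq (ν : Measure unitInterval) [IsFiniteMeasure ν]
    [NullSingletonClass ν] {T : Set unitInterval} (hT : MeasurableSet T) {c : ℝ} (hc : 0 ≤ c)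
    (hcT : c ≤ ν.real T) : ∃ P ⊆ T, MeasurableSet P ∧ ν.real P = c := by
  have h0 : ν.real (T ∩ Iic 0) = 0 := by
    have : (T ∩ Iic (0 : unitInterval)).Subsingleton := by
      intro a ha b hb
      have h1 := le_antisymm ha.2 unitInterval.nonneg'
      have h2 := le_antisymm hb.2 unitInterval.nonneg'
      rw [h1, h2]
    rw [measureReal_def, this.measure_zero]; rfl
  have h1 : ν.real (T ∩ Iic 1) = ν.real T := by
    congr 1
    exact inter_eq_left.2 fun x _ => unitInterval.le_one'
  obtain ⟨x, hx⟩ := mem_range_of_exists_le_of_exists_ge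
    (continuous_measureReal_inter_Iic ν T) (c := c) ⟨0, by rw [h0]; exact hc⟩
    ⟨1, by rw [h1]; exact hcT⟩
  exact ⟨_, inter_subset_left, hT.inter measurableSet_Iic, hx⟩

theorem exists_disjoint_measureReal_eq {ι : Type*} [Finite ι] (ν : Measure unitInterval)
    [IsFiniteMeasure ν] [NullSingletonClass ν] {T : Set unitInterval} (hT : MeasurableSet T)
    {p : ι → ℝ} (hp : ∀ i, 0 ≤ p i) (hpT : ∑ᶠ i, p i ≤ ν.real T) :
    ∃ P : ι → Set unitInterval, (∀ i, P i ⊆ T) ∧ (∀ i, MeasurableSet (P i)) ∧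
      (Pairwise fun i j => Disjoint (P i) (P j)) ∧ ∀ i, ν.real (P i) = p i := by
  classical
  have := Fintype.ofFinite ι
  rw [finsum_eq_sum_of_fintype] at hpT
  -- Pieces are cut greedily. Keeping `P i` empty off `s` makes the measure used so far equal to the
  -- sum of `p` over `s`, so enough of `T` remains.
  suffices H : ∀ s : Finset ι, ∃ P : ι → Set unitInterval, (∀ i, P i ⊆ T) ∧
      (∀ i, MeasurableSet (P i)) ∧ (Pairwise fun i j => Disjoint (P i) (P j)) ∧
      (∀ i ∈ s, ν.real (P i) = p i) ∧ ∀ i ∉ s, P i = ∅ by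
    obtain ⟨P, h1, h2, h3, h4, -⟩ := H Finset.univ
    exact ⟨P, h1, h2, h3, fun i => h4 i (Finset.mem_univ i)⟩
  intro s
  induction s using Finset.induction_on with
  | empty => exact ⟨fun _ => ∅, by simp, by simp, fun i j _ => by simp, by simp, by simp⟩
  | insert a s ha ih =>
    obtain ⟨P, h1, h2, h3, h4, h5⟩ := ih
    have hU : MeasurableSet (⋃ i, P i) := MeasurableSet.iUnion h2
    have hUm : ν.real (⋃ i, P i) = ∑ i ∈ s, p i := by
      rw [measureReal_iUnion_fintype h3 h2, ← Finset.sum_subset (Finset.subset_univ s)]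
      · exact Finset.sum_congr rfl h4
      · intro i _ hi; simp [h5 i hi]
    have hle : p a ≤ ν.real (T \ ⋃ i, P i) := by
      rw [measureReal_sdiff (iUnion_subset h1) hU, hUm]
      have := Finset.sum_le_univ_sum_of_nonneg hp (s := insert a s)
      rw [Finset.sum_insert ha] at this
      linarith
    obtain ⟨Q, hQ, hQm, hQv⟩ := exists_measurable_subset_measureReal_eq ν (hT.diff hU) (hp a) hle
    have hQd : ∀ i, Disjoint Q (P i) := fun i =>
      (disjoint_sdiff_self_left (x := ⋃ i, P i) (y := T)).mono hQ (subset_iUnion P i)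
    refine ⟨Function.update P a Q, ?_, ?_, ?_, ?_, ?_⟩
    · intro i
      rcases eq_or_ne i a with rfl | hi
      · simpa using hQ.trans sdiff_subset
      · simpa [hi] using h1 i
    · intro i
      rcases eq_or_ne i a with rfl | hi
      · simpa using hQm
      · simpa [hi] using h2 i
    · intro i j hij
      rcases eq_or_ne i a with rfl | hi
      · simpa [hij.symm] using hQd j
      · rcases eq_or_ne j a with rfl | hj
        · simpa [hi] using (hQd i).symm
        · simpa [hi, hj] using h3 hij
    · intro i hi
      rcases eq_or_ne i a with rfl | hia
      · simpa using hQv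
      · simpa [hia] using h4 i (Finset.mem_of_mem_insert_of_ne hi hia)
    · intro i hi
      rw [Finset.mem_insert, not_or] at hi
      simpa [hi.1] using h5 i hi.2

/-! ### Utilities -/

namespace Utility

instance (u : Utility) : IsProbabilityMeasure u.toMeasure := u.isProbabilityMeasure

instance (u : Utility) : NullSingletonClass u.toMeasure where
  measure_singleton x := by
    by_contra h
    obtain ⟨t, ht, -, h1, h2⟩ := u.nonatomic {x} (measurableSet_singleton x) (pos_iff_ne_zero.2 h)
    rcases subset_singleton_iff_eq.1 ht with rfl | rfl
    · simp at h1
    · exact lt_irrefl _ h2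

/-- A probability measure without point masses on the cake is a utility function. -/
def ofMeasure (ν : Measure unitInterval) [IsProbabilityMeasure ν] [NullSingletonClass ν] :
    Utility where
  toMeasure := ν
  isProbabilityMeasure := inferInstance
  nonatomic s hs h := by
    have h' : 0 < ν.real s := ENNReal.toReal_pos h.ne' (measure_ne_top _ _)
    obtain ⟨P, hP, hPm, hPv⟩ := exists_measurable_subset_measureReal_eq ν hs
      (half_pos h').le (half_le_self h'.le)
    refine ⟨P, hP, hPm, pos_iff_ne_zero.2 fun h0 => ?_, ?_⟩
    · rw [measureReal_def, h0] at hPv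
      simp at hPv; linarith
    · rw [← ENNReal.toReal_lt_toReal (measure_ne_top _ _) (measure_ne_top _ _)]
      change ν.real P < ν.real s
      linarith

theorem val_nonneg (u : Utility) (S : Set unitInterval) : 0 ≤ u.val S := measureReal_nonneg

theorem val_le_one (u : Utility) (S : Set unitInterval) : u.val S ≤ 1 := measureReal_le_one

theorem val_mono (u : Utility) {S T : Set unitInterval} (h : S ⊆ T) : u.val S ≤ u.val T :=
  measureReal_mono h

theorem val_univ (u : Utility) : u.val univ = 1 := probReal_univ

theorem val_union (u : Utility) {S T : Set unitInterval} (h : Disjoint S T)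
    (hT : MeasurableSet T) : u.val (S ∪ T) = u.val S + u.val T :=
  measureReal_union h hT

theorem val_sdiff (u : Utility) {S T : Set unitInterval} (h : T ⊆ S)
    (hT : MeasurableSet T) : u.val (S \ T) = u.val S - u.val T :=
  measureReal_sdiff h hT

theorem sum_val_piece {n : ℕ} (u : Utility) (X : Allocation n) : ∑ i, u.val (X.piece i) = 1 := by
  rw [← u.val_univ, ← X.iUnion_piece]
  exact (measureReal_iUnion_fintype X.disjoint_piece X.measurableSet_piece).symm

end Utility

/-! ### Nash-optimal allocations are Pareto-optimal and envy-free -/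

namespace Allocation

variable {n : ℕ} {X : Allocation n} {θ : Fin n → Utility}

/-- The allocation obtained from `X` by handing the piece `Z` over to agent `i`. -/
def give (X : Allocation n) (i : Fin n) {Z : Set unitInterval} (hZ : MeasurableSet Z) :
    Allocation n where
  piece k := if k = i then X.piece i ∪ Z else X.piece k \ Z
  measurableSet_piece k := by
    split_ifs
    · exact (X.measurableSet_piece i).union hZ
    · exact (X.measurableSet_piece k).diff hZ
  disjoint_piece k l hkl := by
    have hd : ∀ m, m ≠ i → Disjoint (X.piece i ∪ Z) (X.piece m \ Z) := fun m hm =>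
      disjoint_union_left.2 ⟨(X.disjoint_piece hm.symm).mono_right sdiff_subset,
        disjoint_sdiff_self_right⟩
    rcases eq_or_ne k i with rfl | hk
    · simpa [hkl.symm] using hd l hkl.symm
    · rcases eq_or_ne l i with rfl | hl
      · simpa [hk] using (hd k hk).symm
      · simpa [hk, hl] using (X.disjoint_piece hkl).mono sdiff_subset sdiff_subset
  iUnion_piece := by
    refine eq_univ_of_forall fun x => mem_iUnion.2 ?_
    by_cases hx : x ∈ Z
    · exact ⟨i, by simp [hx]⟩
    · obtain ⟨k, hk⟩ := mem_iUnion.1 (X.iUnion_piece.symm ▸ mem_univ x : x ∈ ⋃ k, X.piece k)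
      refine ⟨k, ?_⟩
      rcases eq_or_ne k i with rfl | hki
      · simp [hk]
      · simp [hk, hki, hx]

theorem give_piece_self (X : Allocation n) (i : Fin n) {Z : Set unitInterval}
    (hZ : MeasurableSet Z) : (X.give i hZ).piece i = X.piece i ∪ Z := if_pos rfl

theorem give_piece_of_ne (X : Allocation n) {i k : Fin n} (h : k ≠ i) {Z : Set unitInterval}
    (hZ : MeasurableSet Z) : (X.give i hZ).piece k = X.piece k \ Z := if_neg h

theorem val_piece_pos (hpos : 0 < ∏ i, (θ i).val (X.piece i)) (i : Fin n) :
    0 < (θ i).val (X.piece i) :=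
  ((θ i).val_nonneg _).lt_of_ne' fun h =>
    hpos.ne' (Finset.prod_eq_zero (Finset.mem_univ i) h)

theorem IsNashOptimal.isParetoOptimal (hX : X.IsNashOptimal θ)
    (hpos : 0 < ∏ i, (θ i).val (X.piece i)) : X.IsParetoOptimal θ := by
  rintro ⟨Y, hY, i, hi⟩
  exact (hX Y).not_gt (Finset.prod_lt_prod (fun k _ => val_piece_pos hpos k) (fun k _ => hY k)
    ⟨i, Finset.mem_univ i, hi⟩)

/-- Moving `Z` from `j` to `i` cannot raise the product, and the positive factors of the other
agents cancel. -/
theorem IsNashOptimal.transfer_le (hX : X.IsNashOptimal θ)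
    (hpos : 0 < ∏ i, (θ i).val (X.piece i)) {i j : Fin n} (hij : i ≠ j) {Z : Set unitInterval}
    (hZ : MeasurableSet Z) (hZj : Z ⊆ X.piece j) :
    ((θ i).val (X.piece i) + (θ i).val Z) * ((θ j).val (X.piece j) - (θ j).val Z) ≤
      (θ i).val (X.piece i) * (θ j).val (X.piece j) := by
  have hji : j ∈ Finset.univ.erase i := Finset.mem_erase.2 ⟨hij.symm, Finset.mem_univ j⟩
  have h := hX (X.give i hZ)
  rw [← Finset.mul_prod_erase _ _ (Finset.mem_univ i), ← Finset.mul_prod_erase _ _ hji,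
    ← Finset.mul_prod_erase _ _ (Finset.mem_univ i), ← Finset.mul_prod_erase _ _ hji,
    ← mul_assoc, ← mul_assoc, give_piece_self, give_piece_of_ne X hij.symm,
    (θ i).val_union ((X.disjoint_piece hij).mono_right hZj) hZ, (θ j).val_sdiff hZj hZ] at h
  refine le_of_mul_le_mul_right (h.trans_eq' (congrArg _ (Finset.prod_congr rfl ?_)))
    (Finset.prod_pos fun k _ => val_piece_pos hpos k)
  intro k hk
  rw [Finset.mem_erase, Finset.mem_erase] at hk
  rw [give_piece_of_ne X hk.2.1, sdiff_eq_left.2 ((X.disjoint_piece hk.1).mono_right hZj)]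

/-- A transfer changes the product to first order by `b * u_i(Z) - a * u_j(Z)`, with error `u_i(Z) *
u_j(Z)`. Summed over `N` small parts of `X_j`, the first-order terms add up to `b * (u_i(X_j) - a)`
while the errors add up to at most `2 / N`. -/
theorem IsNashOptimal.isEnvyFree (hX : X.IsNashOptimal θ)
    (hpos : 0 < ∏ i, (θ i).val (X.piece i)) : X.IsEnvyFree θ := by
  intro i j
  rcases eq_or_ne i j with rfl | hij
  · exact le_rfl
  by_contra! hlt
  set a := (θ i).val (X.piece i) with ha
  set b := (θ j).val (X.piece j) with hb
  have hbpos : 0 < b := val_piece_pos hpos j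
  -- Equal parts for the sum of both measures are small for each of them.
  set ρ : Measure unitInterval := (θ i).toMeasure + (θ j).toMeasure with hρ
  have hρval : ∀ S, ρ.real S = (θ i).val S + (θ j).val S := fun S => measureReal_add_apply
  have : NullSingletonClass ρ := ⟨fun x => by simp [hρ]⟩
  obtain ⟨N, hN⟩ := exists_nat_gt (2 / (b * ((θ i).val (X.piece j) - a)))
  have hdpos : 0 < b * ((θ i).val (X.piece j) - a) := mul_pos hbpos (sub_pos.2 hlt)
  have hNpos : 0 < (N : ℝ) := lt_trans (by positivity) hN
  obtain ⟨P, hPs, hPm, hPd, hPv⟩ := exists_disjoint_measureReal_eq (ι := Fin N) ρ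
    (X.measurableSet_piece j) (p := fun _ => ρ.real (X.piece j) / N)
    (fun _ => by positivity) (by
      rw [finsum_eq_sum_of_fintype]
      simp [mul_div_cancel₀ _ hNpos.ne'])
  have hρU : ρ.real (⋃ k, P k) = ρ.real (X.piece j) := by
    rw [measureReal_iUnion_fintype hPd hPm, Finset.sum_congr rfl fun k _ => hPv k]
    simp [mul_div_cancel₀ _ hNpos.ne']
  have hUs : ⋃ k, P k ⊆ X.piece j := iUnion_subset hPs
  rw [hρval, hρval] at hρU
  have hi := (θ i).val_mono hUs
  have hj := (θ j).val_mono hUs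
  -- The parts exhaust the piece up to a `ρ`-null set: neither measure can exceed its value on the
  -- piece and the totals agree, so each one agrees.
  have hsi : ∑ k, (θ i).val (P k) = (θ i).val (X.piece j) :=
    (measureReal_iUnion_fintype hPd hPm).symm.trans (by change (θ i).val _ = _; linarith)
  have hsj : ∑ k, (θ j).val (P k) = b :=
    (measureReal_iUnion_fintype hPd hPm).symm.trans (by change (θ j).val _ = _; linarith)
  have hk : ∀ k, b * (θ i).val (P k) ≤ a * (θ j).val (P k) + (2 / N) * (θ i).val (P k) := by
    intro k
    have h1 := hX.transfer_le hpos hij (hPm k) (hPs k)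
    have h2 : (θ j).val (P k) ≤ 2 / N := by
      have h3 := hPv k
      rw [hρval] at h3
      have h4 : ρ.real (X.piece j) / N ≤ 2 / N := by
        gcongr
        rw [hρval]
        linarith [(θ i).val_le_one (X.piece j), (θ j).val_le_one (X.piece j)]
      linarith [(θ i).val_nonneg (P k)]
    nlinarith [mul_le_mul_of_nonneg_right h2 ((θ i).val_nonneg (P k))]
  have hsum := Finset.sum_le_sum fun k (_ : k ∈ Finset.univ) => hk k
  rw [Finset.sum_add_distrib, ← Finset.mul_sum, ← Finset.mul_sum, ← Finset.mul_sum, hsi, hsj]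
    at hsum
  have h2N : 2 / (N : ℝ) < b * ((θ i).val (X.piece j) - a) := by
    rw [div_lt_iff₀ hNpos, mul_comm]
    exact (div_lt_iff₀ hdpos).1 hN
  have : 2 / (N : ℝ) * (θ i).val (X.piece j) ≤ 2 / N :=
    mul_le_of_le_one_right (by positivity) ((θ i).val_le_one _)
  linarith

theorem IsEnvyFree.one_le_mul_val (h : X.IsEnvyFree θ) (i : Fin n) :
    1 ≤ n * (θ i).val (X.piece i) := by
  rw [← (θ i).sum_val_piece X]
  simpa using Finset.sum_le_card_nsmul Finset.univ _ _ fun k _ => h i k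

end Allocation

/-! ### Manipulations that are not obvious -/

namespace DirectMechanism

variable {n : ℕ} {M : DirectMechanism n}

theorem bddBelow_range_payoff (M : DirectMechanism n) (i : Fin n) (t r : Utility) :
    BddBelow (range (M.payoff i t r)) := ⟨0, by rintro _ ⟨θ, rfl⟩; exact t.val_nonneg _⟩

theorem bddAbove_range_payoff (M : DirectMechanism n) (i : Fin n) (t r : Utility) :
    BddAbove (range (M.payoff i t r)) := ⟨1, by rintro _ ⟨θ, rfl⟩; exact t.val_le_one _⟩

theorem IsEnvyFree.inv_le_iInf_payoff (hM : M.IsEnvyFree) (i : Fin n) (t : Utility) :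
    (n : ℝ)⁻¹ ≤ ⨅ θ, M.payoff i t t θ := by
  have : Nonempty (Fin n → Utility) := ⟨fun _ => t⟩
  have hn : (0 : ℝ) < n := Nat.cast_pos.2 i.pos
  refine le_ciInf fun θ => ?_
  have h := (hM (Function.update θ i t)).one_le_mul_val i
  rw [Function.update_self] at h
  exact (inv_le_iff_one_le_mul₀' hn).2 h

theorem IsEnvyFree.iInf_payoff_le_inv (hM : M.IsEnvyFree) (i : Fin n) (t r : Utility) :
    ⨅ θ, M.payoff i t r θ ≤ (n : ℝ)⁻¹ := by
  have hn : (0 : ℝ) < n := Nat.cast_pos.2 i.pos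
  -- The bad case for the liar: everybody else reports his true type `t`.
  refine (ciInf_le (M.bddBelow_range_payoff i t r) fun _ => t).trans ?_
  set X := M (Function.update (fun _ => t) i r) with hX
  have h : ∀ k, t.val (X.piece i) ≤ t.val (X.piece k) := by
    intro k
    rcases eq_or_ne k i with rfl | hk
    · exact le_rfl
    · have := hM (Function.update (fun _ => t) i r) k i
      rwa [Function.update_of_ne hk] at this
  have h' := Finset.card_nsmul_le_sum Finset.univ _ _ fun k _ => h k
  rw [t.sum_val_piece X] at h'
  change t.val (X.piece i) ≤ _
  rw [← one_div, le_div_iff₀' hn]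
  simpa using h'

/-- Let the others report `t` conditioned on a set `I` of small `t`-value. The complement of `I` is
worthless to them, so giving it to agent `i` would be a Pareto improvement if he had less than `1 -
ε`. -/
theorem IsParetoOptimal.one_le_iSup_payoff (hM : M.IsParetoOptimal) (i : Fin n) (t : Utility) :
    1 ≤ ⨆ θ, M.payoff i t t θ := by
  refine le_of_forall_pos_sub_le fun ε hε => ?_
  -- The value of `I` is `min ε 1`, as no piece is worth more than `1`.
  obtain ⟨I, -, hIm, hIv⟩ := exists_measurable_subset_measureReal_eq t.toMeasure MeasurableSet.univ
    (le_min hε.le zero_le_one) ((min_le_right ε 1).trans_eq probReal_univ.symm)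
  have hI0 : t.toMeasure I ≠ 0 := fun h => by
    rw [measureReal_def, h] at hIv
    exact (lt_min hε one_pos).ne hIv
  have := ProbabilityTheory.cond_isProbabilityMeasure hI0
  have : NullSingletonClass (ProbabilityTheory.cond t.toMeasure I) :=
    ⟨fun x => ProbabilityTheory.cond_absolutelyContinuous (measure_singleton x)⟩
  set τ := Utility.ofMeasure (ProbabilityTheory.cond t.toMeasure I) with hτ
  refine le_trans ?_ (le_ciSup (M.bddAbove_range_payoff i t t) fun _ => τ)
  set θ := Function.update (fun _ => τ) i t with hθ
  change _ ≤ t.val ((M θ).piece i)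
  have hτI : τ.val Iᶜ = 0 := by
    have : ProbabilityTheory.cond t.toMeasure I Iᶜ = 0 := by
      rw [ProbabilityTheory.cond_apply hIm]; simp
    change (ProbabilityTheory.cond t.toMeasure I).real Iᶜ = 0
    rw [measureReal_def, this]; rfl
  have hIc : 1 - ε ≤ t.val Iᶜ := by
    have : t.val Iᶜ = 1 - t.val I := by
      change t.toMeasure.real Iᶜ = 1 - t.toMeasure.real I
      rw [measureReal_compl hIm, probReal_univ]
    have h' : t.val I = min ε 1 := hIv
    rw [this, h']
    linarith [min_le_left ε 1]
  by_contra! hlt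
  refine hM θ ⟨(M θ).give i hIm.compl, fun k => ?_, i, ?_⟩
  · rcases eq_or_ne k i with rfl | hk
    · rw [Allocation.give_piece_self]
      exact (θ k).val_mono subset_union_left
    · rw [Allocation.give_piece_of_ne _ hk, hθ, Function.update_of_ne hk]
      refine (τ.val_mono (subset_sdiff_union _ Iᶜ)).trans ((measureReal_union_le _ _).trans ?_)
      change τ.val _ + τ.val _ ≤ _
      rw [hτI, add_zero]
  · rw [Allocation.give_piece_self, hθ, Function.update_self]
    exact hlt.trans_le (hIc.trans (t.val_mono subset_union_right))

theorem isNotObviouslyManipulable (hE : M.IsEnvyFree) (hP : M.IsParetoOptimal) :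
    M.IsNotObviouslyManipulable := fun i t r _ =>
  ⟨(hE.iInf_payoff_le_inv i t r).trans (hE.inv_le_iInf_payoff i t),
    have : Nonempty (Fin n → Utility) := ⟨fun _ => t⟩
    (ciSup_le fun _ => t.val_le_one _).trans (hP.one_le_iSup_payoff i t)⟩

end DirectMechanism

/-! ### Fractional allocations -/

/-- A fractional allocation: agent `i` receives the share `f i x` of the point `x`. -/
structure IsFractional {n : ℕ} (f : Fin n → unitInterval → ℝ) : Prop where
  measurable : ∀ i, Measurable (f i)
  nonneg : ∀ i x, 0 ≤ f i x
  sum_eq_one : ∀ x, ∑ i, f i x = 1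

namespace IsFractional

variable {n : ℕ} {f : Fin n → unitInterval → ℝ}

theorem le_one (hf : IsFractional f) (i : Fin n) (x : unitInterval) : f i x ≤ 1 :=
  hf.sum_eq_one x ▸ Finset.single_le_sum (fun k _ => hf.nonneg k x) (Finset.mem_univ i)

theorem norm_le_one (hf : IsFractional f) (i : Fin n) (x : unitInterval) : ‖f i x‖ ≤ 1 := by
  rw [Real.norm_eq_abs, abs_of_nonneg (hf.nonneg i x)]
  exact hf.le_one i x

theorem integrable_mul (hf : IsFractional f) (i : Fin n) {μ : Measure unitInterval}
    {g : unitInterval → ℝ} (hg : Integrable g μ) : Integrable (fun x => f i x * g x) μ :=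
  hg.bdd_mul (hf.measurable i).aestronglyMeasurable (Eventually.of_forall (hf.norm_le_one i))

theorem integrable (hf : IsFractional f) (i : Fin n) (μ : Measure unitInterval)
    [IsFiniteMeasure μ] : Integrable (f i) μ :=
  (integrable_const (1 : ℝ)).mono' (hf.measurable i).aestronglyMeasurable
    (Eventually.of_forall (hf.norm_le_one i))

theorem convexCombination {g : Fin n → unitInterval → ℝ} (hf : IsFractional f)
    (hg : IsFractional g) {s t : ℝ} (hs : 0 ≤ s) (ht : 0 ≤ t) (hst : s + t = 1) :
    IsFractional fun i x => s * f i x + t * g i x where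
  measurable i := ((hf.measurable i).const_mul s).add ((hg.measurable i).const_mul t)
  nonneg i x := add_nonneg (mul_nonneg hs (hf.nonneg i x)) (mul_nonneg ht (hg.nonneg i x))
  sum_eq_one x := by
    rw [Finset.sum_add_distrib, ← Finset.mul_sum, ← Finset.mul_sum, hf.sum_eq_one,
      hg.sum_eq_one, mul_one, mul_one, hst]

theorem const (hn : 1 ≤ n) : IsFractional fun (_ : Fin n) _ => (n : ℝ)⁻¹ where
  measurable _ := measurable_const
  nonneg _ _ := by positivity
  sum_eq_one _ := by
    have : (n : ℝ) ≠ 0 := by positivity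
    simp [this]

end IsFractional

theorem Allocation.isFractional {n : ℕ} (X : Allocation n) :
    IsFractional fun i => (X.piece i).indicator fun _ => (1 : ℝ) where
  measurable i := measurable_const.indicator (X.measurableSet_piece i)
  nonneg i x := indicator_nonneg (fun _ _ => zero_le_one) x
  sum_eq_one x := by
    obtain ⟨k, hk⟩ := mem_iUnion.1 (X.iUnion_piece.symm ▸ mem_univ x : x ∈ ⋃ k, X.piece k)
    rw [Finset.sum_eq_single k, indicator_of_mem hk]
    · intro i _ hi
      exact indicator_of_notMem (fun hxi => (X.disjoint_piece hi).notMem_of_mem_left hxi hk) _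
    · simp

/-- The utility vectors of fractional allocations. -/
def fractionalValues {n : ℕ} (θ : Fin n → Utility) : Set (Fin n → ℝ) :=
  {v | ∃ f, IsFractional f ∧ ∀ i, v i = ∫ x, f i x ∂(θ i).toMeasure}

section

variable {n : ℕ} (θ : Fin n → Utility)

theorem Allocation.val_mem_fractionalValues (X : Allocation n) :
    (fun i => (θ i).val (X.piece i)) ∈ fractionalValues θ :=
  ⟨_, X.isFractional, fun i => by
    rw [integral_indicator (X.measurableSet_piece i), setIntegral_const]
    simp [Utility.val]⟩

theorem convex_fractionalValues : Convex ℝ (fractionalValues θ) := by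
  rintro v ⟨f, hf, hv⟩ w ⟨g, hg, hw⟩ s t hs ht hst
  refine ⟨_, hf.convexCombination hg hs ht hst, fun i => ?_⟩
  rw [integral_add ((hf.integrable i _).const_mul s) ((hg.integrable i _).const_mul t),
    integral_const_mul, integral_const_mul, ← hv, ← hw]
  simp

theorem fractionalValues_subset_Icc : fractionalValues θ ⊆ Icc 0 1 := by
  rintro v ⟨f, hf, hv⟩
  refine ⟨fun i => ?_, fun i => ?_⟩
  · rw [hv]
    exact integral_nonneg (hf.nonneg i)
  · rw [hv]
    refine (integral_mono (hf.integrable i _) (integrable_const 1) (hf.le_one i)).trans ?_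
    simp

theorem isCompact_closure_fractionalValues : IsCompact (closure (fractionalValues θ)) :=
  isCompact_Icc.closure_of_subset (fractionalValues_subset_Icc θ)

end

/-! ### First-order condition -/

/-- The sum is the derivative of the product at `t = 0`, where the product equals `1`. -/
theorem sum_nonpos_of_prod_one_add_le_one {ι : Type*} [Fintype ι] {y : ι → ℝ}
    (h : ∀ t ∈ Ioc (0 : ℝ) 1, ∏ i, (1 + t * y i) ≤ 1) : ∑ i, y i ≤ 0 := by
  classical
  have hd : HasDerivAt (fun t : ℝ => ∏ i, (1 + t * y i)) (∑ i, y i) 0 := by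
    have := HasDerivAt.fun_finsetProd (u := Finset.univ) (f := fun i (t : ℝ) => 1 + t * y i)
      (f' := y) (x := 0) fun i _ => by
        simpa using ((hasDerivAt_id (0 : ℝ)).mul_const (y i)).const_add 1
    simpa using this
  have hs := (hasDerivAt_iff_tendsto_slope_left_right.1 hd).2
  refine le_of_tendsto hs ?_
  filter_upwards [Ioc_mem_nhdsGT (zero_lt_one' ℝ)] with t ht
  rw [slope_def_field]
  refine div_nonpos_of_nonpos_of_nonneg ?_ (by linarith [ht.1])
  simpa using h t ht

/-- `a` maximizes the product over the compact closure; equal shares show that the maximum is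
positive. The last inequality is the first-order condition along the segment from `a` to `v`, whose
coordinates relative to `a` are `1 + t * (v i / a i - 1)`. -/
theorem exists_mem_closure_fractionalValues {n : ℕ} (hn : 1 ≤ n) (θ : Fin n → Utility) :
    ∃ a ∈ closure (fractionalValues θ), (∀ i, 0 < a i) ∧
      (∀ v ∈ fractionalValues θ, ∏ i, v i ≤ ∏ i, a i) ∧
      ∀ v ∈ fractionalValues θ, ∑ i, v i / a i ≤ n := by
  have hc : (fun _ => (n : ℝ)⁻¹) ∈ fractionalValues θ := ⟨_, IsFractional.const hn, by simp⟩
  obtain ⟨a, haK, ha⟩ := (isCompact_closure_fractionalValues θ).exists_isMaxOn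
    ⟨_, subset_closure hc⟩ (f := fun v => ∏ i, v i) (by fun_prop)
  have hmax : ∀ v ∈ closure (fractionalValues θ), ∏ i, v i ≤ ∏ i, a i := fun v hv => ha hv
  have hprod : 0 < ∏ i, a i := lt_of_lt_of_le
    (Finset.prod_pos fun _ _ => by positivity) (hmax _ (subset_closure hc))
  have ha0 : ∀ i, 0 < a i := fun i =>
    ((closure_minimal (fractionalValues_subset_Icc θ) isClosed_Icc haK).1 i).lt_of_ne' fun h =>
      hprod.ne' (Finset.prod_eq_zero (Finset.mem_univ i) h)
  refine ⟨a, haK, ha0, fun v hv => hmax v (subset_closure hv), fun v hv => ?_⟩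
  have := sum_nonpos_of_prod_one_add_le_one (y := fun i => v i / a i - 1) fun t ht => by
    have hm := hmax _ ((convex_fractionalValues θ).closure haK (subset_closure hv)
      (sub_nonneg.2 ht.2) ht.1.le (sub_add_cancel 1 t))
    have he : ∀ i, ((1 - t) • a + t • v) i = (1 + t * (v i / a i - 1)) * a i := by
      intro i
      have := (ha0 i).ne'
      simp only [Pi.add_apply, Pi.smul_apply, smul_eq_mul]
      field_simp
      ring
    rw [Finset.prod_congr rfl fun i _ => he i, Finset.prod_mul_distrib] at hm
    exact le_of_mul_le_mul_right (hm.trans_eq (one_mul _).symm) hprod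
  simpa [Finset.sum_sub_distrib] using this

/-! ### Attaining the limits of fractional utility vectors -/

theorem exists_integral_eq_integral_mul {n : ℕ} (θ : Fin n → Utility) :
    ∃ (μ : Measure unitInterval) (g : Fin n → unitInterval → ℝ), IsFiniteMeasure μ ∧
      NullSingletonClass μ ∧ (∀ i, Measurable (g i)) ∧ (∀ i x, 0 ≤ g i x) ∧
      (∀ i, Integrable (g i) μ) ∧
      ∀ i (f : unitInterval → ℝ), ∫ x, f x ∂(θ i).toMeasure = ∫ x, f x * g i x ∂μ := by
  set μ : Measure unitInterval := ∑ i, (θ i).toMeasure with hμ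
  have hac : ∀ i, (θ i).toMeasure ≪ μ := fun i s hs => by
    rw [hμ, Measure.finsetSum_apply, Finset.sum_eq_zero_iff] at hs
    exact hs i (Finset.mem_univ i)
  refine ⟨μ, fun i x => ((θ i).toMeasure.rnDeriv μ x).toReal, ?_, ⟨fun x => ?_⟩,
    fun i => (Measure.measurable_rnDeriv _ _).ennreal_toReal, fun i x => ENNReal.toReal_nonneg,
    fun i => Measure.integrable_toReal_rnDeriv, fun i f => ?_⟩
  · infer_instance
  · rw [hμ, Measure.finsetSum_apply]
    simp
  · rw [← integral_rnDeriv_smul (hac i)]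
    simp [mul_comm]

/-- If the integrals of `f k * h` tend to `0`, where `h > 0` and `0 ≤ f k ≤ 1`, then those of
`f k * m` have no positive limit. -/
theorem nonpos_of_tendsto_integral_mul {α : Type*} [MeasurableSpace α] {μ : Measure α}
    {f : ℕ → α → ℝ} {h m : α → ℝ} (hf : ∀ k, Measurable (f k)) (hf0 : ∀ k x, 0 ≤ f k x)
    (hf1 : ∀ k x, f k x ≤ 1) (hh : Measurable h) (hh0 : ∀ᵐ x ∂μ, 0 < h x) (hhi : Integrable h μ)
    (hm : Measurable m) (hm0 : ∀ x, 0 ≤ m x) (hmi : Integrable m μ)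
    (hlim : Tendsto (fun k => ∫ x, f k x * h x ∂μ) atTop (𝓝 0)) {p : ℝ}
    (hp : Tendsto (fun k => ∫ x, f k x * m x ∂μ) atTop (𝓝 p)) : p ≤ 0 := by
  -- Off `A C` one has `m ≤ C * h`, so `∫ f k * m ≤ C * ∫ f k * h + ∫ m` with the last integral over
  -- `A C`. Let `k → ∞`, then `C → ∞`; the tail vanishes by dominated convergence since `h > 0`
  -- almost everywhere.
  set A : ℕ → Set α := fun C => {x | C * h x < m x} with hA
  have hAm : ∀ C, MeasurableSet (A C) := fun C => measurableSet_lt (hh.const_mul _) hm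
  have hfi : ∀ k {g : α → ℝ}, Integrable g μ → Integrable (fun x => f k x * g x) μ :=
    fun k g hg => hg.bdd_mul (c := 1) (hf k).aestronglyMeasurable (Eventually.of_forall fun x => by
      rw [Real.norm_eq_abs, abs_of_nonneg (hf0 k x)]
      exact hf1 k x)
  have hr : Tendsto (fun C => ∫ x, (A C).indicator m x ∂μ) atTop (𝓝 (∫ _, (0 : ℝ) ∂μ)) := by
    refine tendsto_integral_of_dominated_convergence m
      (fun C => (hm.indicator (hAm C)).aestronglyMeasurable) hmi (fun C => ?_) ?_
    · refine Eventually.of_forall fun x => ?_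
      rw [Real.norm_eq_abs, abs_of_nonneg (indicator_nonneg (fun y _ => hm0 y) x)]
      exact indicator_le_self' (fun y _ => hm0 y) x
    · filter_upwards [hh0] with x hx
      refine tendsto_const_nhds.congr' ?_
      obtain ⟨N, hN⟩ := exists_nat_ge (m x / h x)
      filter_upwards [eventually_ge_atTop N] with C hC
      refine (indicator_of_notMem ?_ _).symm
      simp only [hA, mem_ofPred_eq, not_lt]
      exact (div_le_iff₀ hx).1 (hN.trans (Nat.cast_le.2 hC))
  rw [integral_zero] at hr
  refine ge_of_tendsto' hr fun C => ?_
  have hup : Tendsto (fun k => C * ∫ x, f k x * h x ∂μ + ∫ x, (A C).indicator m x ∂μ) atTop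
      (𝓝 (C * 0 + ∫ x, (A C).indicator m x ∂μ)) := (hlim.const_mul _).add_const _
  rw [mul_zero, zero_add] at hup
  refine le_of_tendsto_of_tendsto' hp hup fun k => ?_
  have hind : Integrable ((A C).indicator m) μ := hmi.indicator (hAm C)
  rw [← integral_const_mul, ← integral_add ((hfi k hhi).const_mul _) hind]
  refine integral_mono_ae (hfi k hmi) (((hfi k hhi).const_mul _).add hind) ?_
  filter_upwards [hh0] with x hx
  by_cases hxA : x ∈ A C
  · simp only [indicator_of_mem hxA]
    have h1 : f k x * m x ≤ m x := mul_le_of_le_one_left (hm0 x) (hf1 k x)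
    have h2 : 0 ≤ C * (f k x * h x) := mul_nonneg C.cast_nonneg (mul_nonneg (hf0 k x) hx.le)
    linarith
  · simp only [indicator_of_notMem hxA, add_zero]
    have h1 : m x ≤ C * h x := not_lt.1 hxA
    nlinarith [mul_le_mul_of_nonneg_left h1 (hf0 k x)]

theorem Allocation.exists_subset_piece {n : ℕ} (hn : 1 ≤ n) {B : Fin n → Set unitInterval}
    (hB : ∀ i, MeasurableSet (B i)) (hd : Pairwise fun i j => Disjoint (B i) (B j)) :
    ∃ X : Allocation n, ∀ i, B i ⊆ X.piece i := by
  set i₀ : Fin n := ⟨0, hn⟩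
  have hR : ∀ i, Disjoint (B i) (⋃ k, B k)ᶜ := fun i =>
    disjoint_compl_right.mono_left (subset_iUnion B i)
  refine ⟨⟨fun i => if i = i₀ then B i ∪ (⋃ k, B k)ᶜ else B i, fun i => ?_, fun i j hij => ?_, ?_⟩,
    fun i => ?_⟩
  · split_ifs
    · exact (hB i).union (MeasurableSet.iUnion hB).compl
    · exact hB i
  · dsimp only
    split_ifs with hi hj hj
    · exact absurd (hi.trans hj.symm) hij
    · exact disjoint_union_left.2 ⟨hd hij, (hR j).symm⟩
    · exact disjoint_union_right.2 ⟨hd hij, hR i⟩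
    · exact hd hij
  · refine eq_univ_of_forall fun x => mem_iUnion.2 ?_
    by_cases hx : x ∈ ⋃ k, B k
    · obtain ⟨k, hk⟩ := mem_iUnion.1 hx
      refine ⟨k, ?_⟩
      split_ifs
      · exact Or.inl hk
      · exact hk
    · exact ⟨i₀, by rw [if_pos rfl]; exact Or.inr hx⟩
  · change B i ⊆ if i = i₀ then B i ∪ (⋃ k, B k)ᶜ else B i
    split_ifs
    · exact subset_union_left
    · exact subset_rfl

/-- The condition `hsum` says that `a` lies on a supporting hyperplane with normal `1 / a i`.
Maximizing that linear functional means giving each point to agents with the largest `g i / a i`,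
and only ties leave freedom. -/
theorem exists_allocation_ge {n : ℕ} (hn : 1 ≤ n) (θ : Fin n → Utility) {a : Fin n → ℝ}
    (ha : a ∈ closure (fractionalValues θ)) (ha0 : ∀ i, 0 < a i)
    (hsum : ∀ v ∈ fractionalValues θ, ∑ i, v i / a i ≤ n) :
    ∃ X : Allocation n, ∀ i, a i ≤ (θ i).val (X.piece i) := by
  classical
  obtain ⟨μ, g, hμf, hμa, hg, hg0, hgi, hint⟩ := exists_integral_eq_integral_mul θ
  have hne : (Finset.univ : Finset (Fin n)).Nonempty := ⟨⟨0, hn⟩, Finset.mem_univ _⟩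
  obtain ⟨m, hm, hgm, hmax⟩ : ∃ m : unitInterval → ℝ, Measurable m ∧
      (∀ i x, g i x ≤ a i * m x) ∧ ∀ x, ∃ i, g i x = a i * m x := by
    refine ⟨Finset.univ.sup' hne fun i x => g i x / a i,
      Finset.measurable_sup' hne fun i _ => (hg i).div_const _, fun i x => ?_, fun x => ?_⟩
    · rw [Finset.sup'_apply, ← div_le_iff₀' (ha0 i)]
      exact Finset.le_sup' (fun i => g i x / a i) (Finset.mem_univ i)
    · rw [Finset.sup'_apply]
      obtain ⟨i, -, hi⟩ := Finset.exists_mem_eq_sup' hne fun i => g i x / a i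
      exact ⟨i, by rw [hi, mul_div_cancel₀ _ (ha0 i).ne']⟩
  have hm0 : ∀ x, 0 ≤ m x := fun x =>
    nonneg_of_mul_nonneg_right ((hg0 ⟨0, hn⟩ x).trans (hgm _ x)) (ha0 _)
  have hmi : Integrable m μ := by
    refine (integrable_finsetSum Finset.univ fun i _ => (hgi i).div_const (a i)).mono'
      hm.aestronglyMeasurable (Eventually.of_forall fun x => ?_)
    obtain ⟨i, hi⟩ := hmax x
    rw [Real.norm_eq_abs, abs_of_nonneg (hm0 x)]
    refine le_trans (le_of_eq ?_) (Finset.single_le_sum (f := fun i => g i x / a i)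
      (fun k _ => div_nonneg (hg0 k x) (ha0 k).le) (Finset.mem_univ i))
    rw [hi, mul_div_cancel_left₀ _ (ha0 i).ne']
  have hfm : ∀ {f : Fin n → unitInterval → ℝ}, IsFractional f → ∀ B : Set unitInterval,
      ∑ i, ∫ x in B, f i x * m x ∂μ = ∫ x in B, m x ∂μ := by
    intro f hf B
    rw [← integral_finsetSum _ fun i _ => hf.integrable_mul i hmi.integrableOn]
    simp_rw [← Finset.sum_mul, hf.sum_eq_one, one_mul]
  -- sharing every point equally among the agents with maximal ratio
  have hmn : ∫ x, m x ∂μ ≤ n := by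
    set e : Fin n → unitInterval → ℝ := fun i x => if g i x = a i * m x then 1 else 0 with he
    have hem : ∀ i, Measurable (e i) := fun i =>
      Measurable.ite (measurableSet_eq_fun (hg i) (hm.const_mul _)) measurable_const
        measurable_const
    have he0 : ∀ i x, 0 ≤ e i x := fun i x => by
      simp only [he]; split_ifs <;> norm_num
    have hpos : ∀ x, 0 < ∑ k, e k x := fun x => by
      obtain ⟨i, hi⟩ := hmax x
      refine Finset.sum_pos' (fun k _ => he0 k x) ⟨i, Finset.mem_univ i, ?_⟩
      simp only [he, if_pos hi, zero_lt_one]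
    have hF : IsFractional fun i x => e i x / ∑ k, e k x :=
      ⟨fun i => (hem i).div (Finset.measurable_fun_sum _ fun k _ => hem k),
        fun i x => div_nonneg (he0 i x) (hpos x).le,
        fun x => by rw [← Finset.sum_div, div_self (hpos x).ne']⟩
    -- Here `∑ v i / a i` is exactly `∫ m`, because agent `i` has a share only where `g i = a i *
    -- m`.
    have h1 := hsum _ ⟨_, hF, fun i => rfl⟩
    have h2 := hfm hF univ
    simp only [setIntegral_univ] at h2
    rw [← h2]
    refine le_of_eq_of_le (Finset.sum_congr rfl fun i _ => ?_) h1
    rw [hint, eq_div_iff (ha0 i).ne', ← integral_mul_const]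
    congr 1
    funext x
    by_cases hx : g i x = a i * m x
    · rw [hx]; ring
    · simp [he, hx]
  -- The cake is divided by the exact set `S` of agents who attain the maximum.
  set T : Finset (Fin n) → Set unitInterval := fun S => {x | ∀ i, g i x = a i * m x ↔ i ∈ S}
    with hT
  have hTm : ∀ S, MeasurableSet (T S) := fun S => by
    have : T S = ⋂ i, {x | g i x = a i * m x ↔ i ∈ S} := by
      ext x; simp [hT]
    rw [this]
    refine MeasurableSet.iInter fun i => ?_
    have h := measurableSet_eq_fun (hg i) (hm.const_mul (a i))
    by_cases hi : i ∈ S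
    · simpa [hi] using h
    · simp only [hi, iff_false]
      exact h.compl
  have hTd : Pairwise fun S S' => Disjoint (T S) (T S') := fun S S' hS =>
    disjoint_left.2 fun x hx hx' => hS (Finset.ext fun i => (hx i).symm.trans (hx' i))
  have hTu : ⋃ S, T S = univ := eq_univ_of_forall fun x =>
    mem_iUnion.2 ⟨Finset.univ.filter fun i => g i x = a i * m x, fun i => by simp⟩
  have hTsum : ∀ {h : unitInterval → ℝ}, Integrable h μ →
      ∑ S, ∫ x in T S, h x ∂μ = ∫ x, h x ∂μ := fun {h} hh => by
    rw [← integral_iUnion_fintype hTm hTd fun S => hh.integrableOn, hTu, setIntegral_univ]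
  -- limits of the shares in the cells `T S`
  obtain ⟨v, hv, hva⟩ := mem_closure_iff_seq_limit.1 ha
  choose f hf hfv using hv
  have hfmi : ∀ k i, Integrable (fun x => f k i x * m x) μ := fun k i =>
    (hf k).integrable_mul i hmi
  have hfm0 : ∀ k i x, 0 ≤ f k i x * m x := fun k i x => mul_nonneg ((hf k).nonneg i x) (hm0 x)
  have hpk : ∀ k, (fun q : Finset (Fin n) × Fin n => ∫ x in T q.1, f k q.2 x * m x ∂μ) ∈
      Icc (fun _ => 0) (fun _ => ∫ x, m x ∂μ) := fun k =>
    ⟨fun q => integral_nonneg (hfm0 k q.2), fun q =>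
      (setIntegral_le_integral (hfmi k q.2) (Eventually.of_forall (hfm0 k q.2))).trans
        (integral_mono (hfmi k q.2) hmi fun x =>
          mul_le_of_le_one_left (hm0 x) ((hf k).le_one q.2 x))⟩
  obtain ⟨p, hpI, φ, hφ, hp⟩ := isCompact_Icc.tendsto_subseq hpk
  rw [tendsto_pi_nhds] at hp
  have hp0 : ∀ q, 0 ≤ p q := hpI.1
  have hvφ : ∀ i, Tendsto (fun k => v (φ k) i) atTop (𝓝 (a i)) := fun i =>
    ((tendsto_pi_nhds.1 hva) i).comp hφ.tendsto_atTop
  have hpT : ∀ S, ∑ i, p (S, i) = ∫ x in T S, m x ∂μ := fun S =>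
    tendsto_nhds_unique (tendsto_finsetSum _ fun i _ => hp (S, i))
      (tendsto_const_nhds.congr fun k => (hfm (hf (φ k)) (T S)).symm)
  have hgap : ∀ k i, ∫ x, f k i x * (a i * m x - g i x) ∂μ =
      a i * ∫ x, f k i x * m x ∂μ - v k i := fun k i => by
    rw [hfv, hint, ← integral_const_mul,
      ← integral_sub ((hfmi k i).const_mul _) ((hf k).integrable_mul i (hgi i))]
    congr 1
    funext x
    ring
  have hgap0 : ∀ k i x, 0 ≤ f k i x * (a i * m x - g i x) := fun k i x =>
    mul_nonneg ((hf k).nonneg i x) (sub_nonneg.2 (hgm i x))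
  have hpa : ∀ i, a i ≤ a i * ∑ S, p (S, i) := fun i => by
    refine le_of_tendsto_of_tendsto' (hvφ i)
      ((tendsto_finsetSum _ fun S _ => hp (S, i)).const_mul (a i)) fun k => ?_
    have h1 := hgap (φ k) i ▸ integral_nonneg (hgap0 (φ k) i)
    simp only [Function.comp_apply]
    rw [hTsum (hfmi (φ k) i)]
    exact sub_nonneg.1 h1
  have hgapi : ∀ i, Integrable (fun x => a i * m x - g i x) μ := fun i =>
    (hmi.const_mul _).sub (hgi i)
  -- Divided by `a i` and summed over the agents, these losses equal `∫ m - ∑ v j / a j ≤ n - ∑ v j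
  -- / a j`, which tends to `0`; each of them is nonnegative.
  have hgaplim : ∀ i, Tendsto (fun k => ∫ x, f (φ k) i x * (a i * m x - g i x) ∂μ) atTop
      (𝓝 0) := fun i => by
    have hup : Tendsto (fun k => a i * (n - ∑ j, v (φ k) j / a j)) atTop
        (𝓝 (a i * (n - ∑ j, a j / a j))) :=
      ((tendsto_finsetSum _ fun j _ => (hvφ j).div_const (a j)).const_sub _).const_mul _
    rw [Finset.sum_congr rfl fun j _ => div_self (ha0 j).ne'] at hup
    simp only [Finset.sum_const, Finset.card_univ, Fintype.card_fin, nsmul_eq_mul, mul_one,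
      sub_self, mul_zero] at hup
    refine squeeze_zero (fun k => integral_nonneg (hgap0 (φ k) i)) (fun k => ?_) hup
    rw [← div_le_iff₀' (ha0 i)]
    have h1 : ∑ j, (∫ x, f (φ k) j x * (a j * m x - g j x) ∂μ) / a j =
        ∫ x, m x ∂μ - ∑ j, v (φ k) j / a j := by
      have h2 := hfm (hf (φ k)) univ
      simp only [setIntegral_univ] at h2
      rw [← h2, ← Finset.sum_sub_distrib]
      refine Finset.sum_congr rfl fun j _ => ?_
      rw [hgap, sub_div, mul_div_cancel_left₀ _ (ha0 j).ne']
    have h3 := Finset.single_le_sum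
      (f := fun j => (∫ x, f (φ k) j x * (a j * m x - g j x) ∂μ) / a j)
      (fun j _ => div_nonneg (integral_nonneg (hgap0 (φ k) j)) (ha0 j).le) (Finset.mem_univ i)
    linarith
  -- For `i ∉ S` the gap `a i * m - g i` is strictly positive on `T S`, so a vanishing loss leaves
  -- agent `i` no share there in the limit.
  have hpS : ∀ S, ∀ i ∉ S, p (S, i) = 0 := fun S i hi => by
    refine le_antisymm ?_ (hp0 _)
    refine nonpos_of_tendsto_integral_mul (μ := μ.restrict (T S))
      (h := fun x => a i * m x - g i x) (fun k => (hf (φ k)).measurable i)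
      (fun k => (hf (φ k)).nonneg i) (fun k => (hf (φ k)).le_one i)
      ((hm.const_mul _).sub (hg i)) ?_ (hgapi i).integrableOn hm hm0 hmi.integrableOn ?_
      (hp (S, i))
    · filter_upwards [ae_restrict_mem (hTm S)] with x hx
      exact sub_pos.2 ((hgm i x).lt_of_ne fun h => hi ((hx i).1 h))
    · exact squeeze_zero (fun k => integral_nonneg (hgap0 (φ k) i))
        (fun k => setIntegral_le_integral ((hf (φ k)).integrable_mul i (hgapi i))
          (Eventually.of_forall (hgap0 (φ k) i))) (hgaplim i)
  -- splitting the cells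
  set ν : Measure unitInterval := μ.withDensity fun x => ENNReal.ofReal (m x) with hν
  have hνf : IsFiniteMeasure ν := isFiniteMeasure_withDensity_ofReal hmi.2
  have hνr : ∀ B, MeasurableSet B → ν.real B = ∫ x in B, m x ∂μ := fun B hB => by
    rw [measureReal_def, hν, withDensity_apply _ hB,
      ← ofReal_integral_eq_lintegral_ofReal hmi.integrableOn (Eventually.of_forall hm0),
      ENNReal.toReal_ofReal (integral_nonneg hm0)]
  -- On `T S` the measure of every agent `i ∈ S` is `a i` times `ν`, so splitting the single measure
  -- `ν` serves all of them at once.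
  have hQ : ∀ S, ∃ Q : Fin n → Set unitInterval, (∀ i, Q i ⊆ T S) ∧ (∀ i, MeasurableSet (Q i)) ∧
      (Pairwise fun i j => Disjoint (Q i) (Q j)) ∧ ∀ i, ν.real (Q i) = p (S, i) := fun S =>
    exists_disjoint_measureReal_eq ν (hTm S) (fun i => hp0 (S, i)) (by
      rw [finsum_eq_sum_of_fintype, hpT, hνr _ (hTm S)])
  choose Q hQs hQm hQd hQv using hQ
  obtain ⟨X, hX⟩ := Allocation.exists_subset_piece hn (B := fun i => ⋃ S, Q S i)
    (fun i => MeasurableSet.iUnion fun S => hQm S i) (fun i j hij => by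
      refine disjoint_iUnion_left.2 fun S => disjoint_iUnion_right.2 fun S' => ?_
      rcases eq_or_ne S S' with rfl | hS
      · exact hQd S hij
      · exact (hTd hS).mono (hQs S i) (hQs S' j))
  refine ⟨X, fun i => (hpa i).trans (le_trans ?_ ((θ i).val_mono (hX i)))⟩
  have hU : (θ i).val (⋃ S, Q S i) = ∑ S, (θ i).val (Q S i) :=
    measureReal_iUnion_fintype (fun S S' hS => (hTd hS).mono (hQs S i) (hQs S' i))
      fun S => hQm S i
  rw [hU, Finset.mul_sum]
  refine Finset.sum_le_sum fun S _ => ?_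
  by_cases hi : i ∈ S
  · refine le_of_eq ?_
    have h1 : (θ i).val (Q S i) = ∫ x in Q S i, g i x ∂μ := by
      have h2 := hint i ((Q S i).indicator fun _ => 1)
      rw [integral_indicator (hQm S i), setIntegral_const, smul_eq_mul, mul_one] at h2
      refine h2.trans ?_
      rw [← integral_indicator (hQm S i)]
      congr 1
      funext x
      by_cases hx : x ∈ Q S i <;> simp [hx]
    rw [h1, ← hQv, hνr _ (hQm S i), ← integral_const_mul]
    exact setIntegral_congr_fun (hQm S i) fun x hx => ((hQs S i hx i).2 hi).symm
  · rw [hpS S i hi, mul_zero]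
    exact (θ i).val_nonneg _

theorem exists_isNashOptimal {n : ℕ} (hn : 1 ≤ n) (θ : Fin n → Utility) :
    ∃ X : Allocation n, X.IsNashOptimal θ ∧ 0 < ∏ i, (θ i).val (X.piece i) := by
  obtain ⟨a, ha, ha0, hmax, hsum⟩ := exists_mem_closure_fractionalValues hn θ
  obtain ⟨X, hX⟩ := exists_allocation_ge hn θ ha ha0 hsum
  exact ⟨X, fun Y => (hmax _ (Y.val_mem_fractionalValues θ)).trans
      (Finset.prod_le_prod (fun i _ => (ha0 i).le) fun i _ => hX i),
    Finset.prod_pos fun i _ => (ha0 i).trans_le (hX i)⟩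

/-- Comparison with the optimum already constructed, whose product is positive. -/
theorem Allocation.IsNashOptimal.prod_val_pos {n : ℕ} {X : Allocation n} {θ : Fin n → Utility}
    (hX : X.IsNashOptimal θ) (hn : 1 ≤ n) : 0 < ∏ i, (θ i).val (X.piece i) := by
  obtain ⟨Y, -, hY⟩ := exists_isNashOptimal hn θ
  exact hY.trans_le (hX Y)

end CakeCutting

theorem theorem3 (n : ℕ) (hn : 1 ≤ n) :
    (∃ M : CakeCutting.DirectMechanism n,
      M.IsNashOptimal ∧ M.IsNotObviouslyManipulable ∧ M.IsEnvyFree ∧ M.IsParetoOptimal) ∧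
    (∀ M : CakeCutting.DirectMechanism n, M.IsNashOptimal →
      M.IsNotObviouslyManipulable ∧ M.IsEnvyFree ∧ M.IsParetoOptimal) := by
  have main : ∀ M : CakeCutting.DirectMechanism n, M.IsNashOptimal →
      M.IsNotObviouslyManipulable ∧ M.IsEnvyFree ∧ M.IsParetoOptimal := fun M hM => by
    have hE : M.IsEnvyFree := fun θ => (hM θ).isEnvyFree ((hM θ).prod_val_pos hn)
    have hP : M.IsParetoOptimal := fun θ => (hM θ).isParetoOptimal ((hM θ).prod_val_pos hn)
    exact ⟨CakeCutting.DirectMechanism.isNotObviouslyManipulable hE hP, hE, hP⟩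
  choose M hM using fun θ => CakeCutting.exists_isNashOptimal hn θ
  exact ⟨⟨M, fun θ => (hM θ).1, main M fun θ => (hM θ).1⟩, main⟩
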